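/- Let $d\ge 1$ and let $\Omega$ be either $\mathbb R^d$ or $\mathbb R^d\setminus\{0\}$. Let $\mathcal E_M(\Omega)$ be the algebra of nets $(u_\varepsilon)_{\varepsilon\in(0,1]}$ of smooth complex-valued functions on $\Omega$ such that for every compact $K\subset\Omega$ and every multi-index $\beta\in\mathbb N_0^d$ there is $N\ge 0$ with $\sup_{x\in K}|\partial^\beta u_\varepsilon(x)|=O(\varepsilon^{-N})$ as $\varepsilon\to 0$. Let $\mathcal N(\Omega)$ be the ideal of those nets such that for every such $K$ and $\beta$ and every $m\ge 0$, $\sup_{x\in K}|\partial^\beta u_\varepsilon(x)|=O(\varepsilon^{m})$ as $\varepsilon\to 0$. Let $\mathcal G(\Omega)=\mathcal E_M(\Omega)/\mathcal N(\Omega)$ be the special Colombeau algebra, on which algebraic operations, partial derivatives and the dilations $u\mapsto u(\lambda\,\cdot\,)$ ($\lambda>0$) are defined componentwise on representatives. Let $u\in\mathcal G(\Omega)$ and $\alpha\in\mathbb R$. Then the following are equivalent: 1. $u$ satisfies the Euler equation $\sum_{i=1}^d x_i\,\frac{\partial u}{\partial x_i}=\alpha u$ in $\mathcal G(\Omega)$;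 2. $u$ is homogeneous of degree $\alpha$, that is, for each real $\lambda>0$ the equality $u(\lambda x)=\lambda^\alpha u(x)$ holds in $\mathcal G(\Omega)$. -/

import Mathlib

open TopologicalSpace
open scoped ContDiff

noncomputable section

namespace Colombeau

/-- The Euclidean space `ℝ^d`. -/
abbrev Space (d : ℕ) := EuclideanSpace ℝ (Fin d)

/-- The index set `(0,1]` of the regularisation parameter `ε`. -/
abbrev Param := Set.Ioc (0 : ℝ) 1

/-- Nets `(u_ε)_{ε ∈ (0,1]}` of complex-valued functions. A function on an open set `Ω` is written
as a function on all of `ℝ^d`; its values outside `Ω` are never looked at, and are divided out in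
the algebra below. -/
abbrev Net (d : ℕ) := Param → Space d → ℂ

variable {d : ℕ}

/-- The partial derivative `∂f/∂x_i`. -/
def partialDeriv (i : Fin d) (f : Space d → ℂ) : Space d → ℂ :=
  fun x => fderiv ℝ f x (EuclideanSpace.single i 1)

/-- The iterated partial derivative `∂_{i_k} ⋯ ∂_{i_1} f` along a finite sequence of coordinate
directions. For smooth `f` the order of the directions is irrelevant, so that these are exactly the
derivatives `∂^β f` with `β` a multi-index. -/
def iterPartial : List (Fin d) → (Space d → ℂ) → (Space d → ℂ)
  | [], f => f
  | i :: w, f => iterPartial w (partialDeriv i f)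

/-- `sup_{x ∈ K} |u_ε(x)| = O(ε^r)` as `ε → 0`. -/
def IsBigOOn (K : Set (Space d)) (u : Net d) (r : ℤ) : Prop :=
  ∃ C : ℝ, ∃ η : ℝ, 0 < η ∧ ∀ ε : Param, (ε : ℝ) < η → ∀ x ∈ K, ‖u ε x‖ ≤ C * (ε : ℝ) ^ r

/-- Every `u_ε` is of class `C^∞` on `Ω`. -/
def IsSmoothNet (Ω : Opens (Space d)) (u : Net d) : Prop :=
  ∀ ε : Param, ContDiffOn ℝ ∞ (u ε) Ω

/-- Membership in `E_M(Ω)`. -/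
def IsModerate (Ω : Opens (Space d)) (u : Net d) : Prop :=
  IsSmoothNet Ω u ∧ ∀ K : Set (Space d), IsCompact K → K ⊆ Ω → ∀ w : List (Fin d),
    ∃ N : ℕ, IsBigOOn K (fun ε => iterPartial w (u ε)) (-(N : ℤ))

/-- Membership in `N(Ω)`. -/
def IsNegligible (Ω : Opens (Space d)) (u : Net d) : Prop :=
  IsSmoothNet Ω u ∧ ∀ K : Set (Space d), IsCompact K → K ⊆ Ω → ∀ w : List (Fin d),
    ∀ m : ℕ, IsBigOOn K (fun ε => iterPartial w (u ε)) (m : ℤ)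

/-! ### Elementary facts about derivatives -/

section Derivatives

variable {Ω : Opens (Space d)}

theorem contDiffOn_partialDeriv {f : Space d → ℂ} (hf : ContDiffOn ℝ ∞ f Ω) (i : Fin d) :
    ContDiffOn ℝ ∞ (partialDeriv i f) Ω :=
  (hf.fderiv_of_isOpen Ω.isOpen (by simp)).clm_apply contDiffOn_const

theorem differentiableAt_of_smooth {f : Space d → ℂ} (hf : ContDiffOn ℝ ∞ f Ω) {x : Space d}
    (hx : x ∈ Ω) : DifferentiableAt ℝ f x :=
  (hf.contDiffAt (Ω.isOpen.mem_nhds hx)).differentiableAt (by simp)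

theorem partialDeriv_congr {f g : Space d → ℂ} (h : Set.EqOn f g Ω) (i : Fin d) :
    Set.EqOn (partialDeriv i f) (partialDeriv i g) Ω := by
  intro x hx
  have : f =ᶠ[nhds x] g := Filter.eventuallyEq_of_mem (Ω.isOpen.mem_nhds hx) h
  simp only [partialDeriv, this.fderiv_eq]

theorem iterPartial_congr (w : List (Fin d)) : ∀ {f g : Space d → ℂ}, Set.EqOn f g Ω →
    Set.EqOn (iterPartial w f) (iterPartial w g) Ω := by
  induction w with
  | nil => intro f g h; exact h
  | cons i w ih => intro f g h; exact ih (partialDeriv_congr h i)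

theorem iterPartial_add (w : List (Fin d)) : ∀ {f g : Space d → ℂ}, ContDiffOn ℝ ∞ f Ω →
    ContDiffOn ℝ ∞ g Ω →
    Set.EqOn (iterPartial w (f + g)) (iterPartial w f + iterPartial w g) Ω := by
  induction w with
  | nil => intro f g _ _ x _; rfl
  | cons i w ih =>
    intro f g hf hg
    have h : Set.EqOn (partialDeriv i (f + g)) (partialDeriv i f + partialDeriv i g) Ω := by
      intro x hx
      simp only [partialDeriv, Pi.add_apply]
      rw [fderiv_add (differentiableAt_of_smooth hf hx) (differentiableAt_of_smooth hg hx)]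
      rfl
    exact (iterPartial_congr w h).trans
      (ih (contDiffOn_partialDeriv hf i) (contDiffOn_partialDeriv hg i))

theorem partialDeriv_mul {f g : Space d → ℂ} (hf : ContDiffOn ℝ ∞ f Ω)
    (hg : ContDiffOn ℝ ∞ g Ω) (i : Fin d) :
    Set.EqOn (partialDeriv i (f * g)) (partialDeriv i f * g + f * partialDeriv i g) Ω := by
  intro x hx
  simp only [partialDeriv, Pi.add_apply, Pi.mul_apply]
  rw [fderiv_mul (differentiableAt_of_smooth hf hx) (differentiableAt_of_smooth hg hx)]
  simp
  ring

theorem iterPartial_mul_cons (i : Fin d) (w : List (Fin d)) {f g : Space d → ℂ}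
    (hf : ContDiffOn ℝ ∞ f Ω) (hg : ContDiffOn ℝ ∞ g Ω) :
    Set.EqOn (iterPartial (i :: w) (f * g))
      (iterPartial w (partialDeriv i f * g) + iterPartial w (f * partialDeriv i g)) Ω :=
  (iterPartial_congr w (partialDeriv_mul hf hg i)).trans
    (iterPartial_add w ((contDiffOn_partialDeriv hf i).mul hg)
      (hf.mul (contDiffOn_partialDeriv hg i)))

theorem iterPartial_smul (w : List (Fin d)) (c : ℂ) : ∀ (f : Space d → ℂ),
    iterPartial w (c • f) = c • iterPartial w f := by
  induction w with
  | nil => intro f; rfl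
  | cons i w ih =>
    intro f
    have h : partialDeriv i (c • f) = c • partialDeriv i f := by
      funext x
      simp only [partialDeriv, fderiv_const_smul_field, Pi.smul_apply]
      rfl
    simp only [iterPartial, h, ih]

theorem iterPartial_zero (w : List (Fin d)) : iterPartial w (0 : Space d → ℂ) = 0 := by
  have := iterPartial_smul w 0 (0 : Space d → ℂ)
  simpa using this

theorem partialDeriv_const (i : Fin d) (c : ℂ) : partialDeriv i (fun _ => c) = 0 := by
  funext x
  simp [partialDeriv]

theorem iterPartial_dilate (w : List (Fin d)) (r : ℝ) : ∀ (f : Space d → ℂ),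
    iterPartial w (fun x => f (r • x)) =
      ((r : ℂ) ^ w.length) • fun x => iterPartial w f (r • x) := by
  induction w with
  | nil => intro f; funext x; simp [iterPartial]
  | cons i w ih =>
    intro f
    have h : partialDeriv i (fun x => f (r • x)) =
        (r : ℂ) • fun x => partialDeriv i f (r • x) := by
      funext x
      simp only [partialDeriv, Pi.smul_apply]
      rw [fderiv_comp_smul]
      simp
    simp only [iterPartial, h, iterPartial_smul, ih, smul_smul, List.length_cons, pow_succ']

end Derivatives

/-! ### Elementary facts about the growth conditions -/

section Growth

variable {Ω : Opens (Space d)} {K : Set (Space d)} {u v : Net d}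

theorem IsBigOOn.congr {r : ℤ} (h : ∀ ε, Set.EqOn (u ε) (v ε) K) (hu : IsBigOOn K u r) :
    IsBigOOn K v r := by
  obtain ⟨C, η, hη, H⟩ := hu
  exact ⟨C, η, hη, fun ε hε x hx => h ε hx ▸ H ε hε x hx⟩

theorem IsBigOOn.mono {r s : ℤ} (hrs : s ≤ r) (hu : IsBigOOn K u r) : IsBigOOn K u s := by
  obtain ⟨C, η, hη, H⟩ := hu
  refine ⟨|C|, η, hη, fun ε hε x hx => (H ε hε x hx).trans ?_⟩
  have h1 : (ε : ℝ) ^ r ≤ (ε : ℝ) ^ s := zpow_le_zpow_right_of_le_one₀ ε.2.1 ε.2.2 hrs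
  have h2 : (0 : ℝ) ≤ (ε : ℝ) ^ r := zpow_nonneg ε.2.1.le r
  calc C * (ε : ℝ) ^ r ≤ |C| * (ε : ℝ) ^ r := mul_le_mul_of_nonneg_right (le_abs_self C) h2
    _ ≤ |C| * (ε : ℝ) ^ s := mul_le_mul_of_nonneg_left h1 (abs_nonneg C)

theorem IsBigOOn.add {r : ℤ} (hu : IsBigOOn K u r) (hv : IsBigOOn K v r) :
    IsBigOOn K (u + v) r := by
  obtain ⟨C, η, hη, H⟩ := hu
  obtain ⟨C', η', hη', H'⟩ := hv
  refine ⟨C + C', min η η', lt_min hη hη', fun ε hε x hx => ?_⟩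
  rw [add_mul]
  exact (norm_add_le _ _).trans (add_le_add (H ε (hε.trans_le (min_le_left _ _)) x hx)
    (H' ε (hε.trans_le (min_le_right _ _)) x hx))

theorem IsBigOOn.mul {r s : ℤ} (hu : IsBigOOn K u r) (hv : IsBigOOn K v s) :
    IsBigOOn K (u * v) (r + s) := by
  obtain ⟨C, η, hη, H⟩ := hu
  obtain ⟨C', η', hη', H'⟩ := hv
  refine ⟨C * C', min η η', lt_min hη hη', fun ε hε x hx => ?_⟩
  have h1 := H ε (hε.trans_le (min_le_left _ _)) x hx
  have h2 := H' ε (hε.trans_le (min_le_right _ _)) x hx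
  calc ‖(u * v) ε x‖ = ‖u ε x‖ * ‖v ε x‖ := norm_mul _ _
    _ ≤ (C * (ε : ℝ) ^ r) * (C' * (ε : ℝ) ^ s) :=
      mul_le_mul h1 h2 (norm_nonneg _) ((norm_nonneg _).trans h1)
    _ = C * C' * (ε : ℝ) ^ (r + s) := by rw [zpow_add₀ ε.2.1.ne']; ring

theorem IsBigOOn.smul {r : ℤ} (c : ℂ) (hu : IsBigOOn K u r) : IsBigOOn K (c • u) r := by
  obtain ⟨C, η, hη, H⟩ := hu
  refine ⟨‖c‖ * C, η, hη, fun ε hε x hx => ?_⟩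
  calc ‖(c • u) ε x‖ = ‖c‖ * ‖u ε x‖ := norm_mul _ _
    _ ≤ ‖c‖ * (C * (ε : ℝ) ^ r) := mul_le_mul_of_nonneg_left (H ε hε x hx) (norm_nonneg c)
    _ = ‖c‖ * C * (ε : ℝ) ^ r := by ring

theorem isBigOOn_zero (r : ℤ) : IsBigOOn K (0 : Net d) r :=
  ⟨0, 1, one_pos, fun ε _ x _ => by simp⟩

theorem IsNegligible.isModerate (hu : IsNegligible Ω u) : IsModerate Ω u :=
  ⟨hu.1, fun K hK hKΩ w => ⟨0, by simpa using hu.2 K hK hKΩ w 0⟩⟩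

theorem IsModerate.partialDeriv (hu : IsModerate Ω u) (i : Fin d) :
    IsModerate Ω (fun ε => partialDeriv i (u ε)) :=
  ⟨fun ε => contDiffOn_partialDeriv (hu.1 ε) i, fun K hK hKΩ w => hu.2 K hK hKΩ (i :: w)⟩

theorem IsNegligible.partialDeriv (hu : IsNegligible Ω u) (i : Fin d) :
    IsNegligible Ω (fun ε => partialDeriv i (u ε)) :=
  ⟨fun ε => contDiffOn_partialDeriv (hu.1 ε) i, fun K hK hKΩ w => hu.2 K hK hKΩ (i :: w)⟩

theorem IsModerate.add (hu : IsModerate Ω u) (hv : IsModerate Ω v) : IsModerate Ω (u + v) := by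
  refine ⟨fun ε => (hu.1 ε).add (hv.1 ε), fun K hK hKΩ w => ?_⟩
  obtain ⟨N, hN⟩ := hu.2 K hK hKΩ w
  obtain ⟨N', hN'⟩ := hv.2 K hK hKΩ w
  refine ⟨max N N', IsBigOOn.congr (fun ε => ?_)
    ((hN.mono (s := -((max N N' : ℕ) : ℤ)) (by push_cast; omega)).add
      (hN'.mono (s := -((max N N' : ℕ) : ℤ)) (by push_cast; omega)))⟩
  exact ((iterPartial_add w (hu.1 ε) (hv.1 ε)).mono hKΩ).symm

theorem IsNegligible.add (hu : IsNegligible Ω u) (hv : IsNegligible Ω v) :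
    IsNegligible Ω (u + v) := by
  refine ⟨fun ε => (hu.1 ε).add (hv.1 ε), fun K hK hKΩ w m => ?_⟩
  exact IsBigOOn.congr (fun ε => ((iterPartial_add w (hu.1 ε) (hv.1 ε)).mono hKΩ).symm)
    ((hu.2 K hK hKΩ w m).add (hv.2 K hK hKΩ w m))

theorem IsModerate.mul (hu : IsModerate Ω u) (hv : IsModerate Ω v) : IsModerate Ω (u * v) := by
  refine ⟨fun ε => (hu.1 ε).mul (hv.1 ε), fun K hK hKΩ w => ?_⟩
  induction w generalizing u v with
  | nil =>
    obtain ⟨N, hN⟩ := hu.2 K hK hKΩ []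
    obtain ⟨N', hN'⟩ := hv.2 K hK hKΩ []
    exact ⟨N + N', (hN.mul hN').mono (by push_cast; omega)⟩
  | cons i w ih =>
    obtain ⟨N, hN⟩ := ih (hu.partialDeriv i) hv
    obtain ⟨N', hN'⟩ := ih hu (hv.partialDeriv i)
    refine ⟨max N N', IsBigOOn.congr (fun ε => ?_)
      ((hN.mono (s := -((max N N' : ℕ) : ℤ)) (by push_cast; omega)).add
        (hN'.mono (s := -((max N N' : ℕ) : ℤ)) (by push_cast; omega)))⟩
    exact ((iterPartial_mul_cons i w (hu.1 ε) (hv.1 ε)).mono hKΩ).symm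

theorem IsModerate.mul_isNegligible (hu : IsModerate Ω u) (hv : IsNegligible Ω v) :
    IsNegligible Ω (u * v) := by
  refine ⟨fun ε => (hu.1 ε).mul (hv.1 ε), fun K hK hKΩ w => ?_⟩
  induction w generalizing u v with
  | nil =>
    intro m
    obtain ⟨N, hN⟩ := hu.2 K hK hKΩ []
    exact (hN.mul (hv.2 K hK hKΩ [] (m + N))).mono (by push_cast; omega)
  | cons i w ih =>
    intro m
    exact IsBigOOn.congr
      (fun ε => ((iterPartial_mul_cons i w (hu.1 ε) (hv.1 ε)).mono hKΩ).symm)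
      ((ih (hu.partialDeriv i) hv m).add (ih hu (hv.partialDeriv i) m))

theorem isNegligible_zero : IsNegligible Ω (0 : Net d) :=
  ⟨fun _ => contDiffOn_const, fun _ _ _ w m =>
    (isBigOOn_zero (m : ℤ)).congr fun ε x _ => by
      change (0 : ℂ) = iterPartial w (0 : Space d → ℂ) x
      rw [iterPartial_zero]; rfl⟩

/-- A fixed smooth function, as a constant net, is moderate. -/
theorem isModerate_of_smooth {f : Space d → ℂ} (hf : ContDiffOn ℝ ∞ f Ω) :
    IsModerate Ω (fun _ => f) := by
  refine ⟨fun _ => hf, fun K hK hKΩ w => ⟨0, ?_⟩⟩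
  have hc : ContDiffOn ℝ ∞ (iterPartial w f) Ω := by
    induction w generalizing f with
    | nil => exact hf
    | cons i w ih => exact ih (contDiffOn_partialDeriv hf i)
  obtain ⟨C, hC⟩ := hK.exists_bound_of_continuousOn (hc.continuousOn.mono hKΩ)
  exact ⟨C, 1, one_pos, fun ε _ x hx => by simpa using hC x hx⟩

theorem isModerate_dilate {r : ℝ} (hr : ∀ x ∈ Ω, r • x ∈ Ω) (hu : IsModerate Ω u) :
    IsModerate Ω (fun ε x => u ε (r • x)) := by
  refine ⟨fun ε => (hu.1 ε).comp (contDiff_const_smul r).contDiffOn hr, fun K hK hKΩ w => ?_⟩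
  obtain ⟨N, C, η, hη, H⟩ := hu.2 ((fun x => r • x) '' K) (hK.image (continuous_const_smul r))
    (by rintro _ ⟨x, hx, rfl⟩; exact hr x (hKΩ hx)) w
  refine ⟨N, IsBigOOn.congr (fun ε x _ => ?_)
    (IsBigOOn.smul ((r : ℂ) ^ w.length)
      (u := fun ε x => iterPartial w (u ε) (r • x))
      ⟨C, η, hη, fun ε hε x hx => H ε hε _ ⟨x, hx, rfl⟩⟩)⟩
  simp only [iterPartial_dilate]
  rfl

theorem isNegligible_dilate {r : ℝ} (hr : ∀ x ∈ Ω, r • x ∈ Ω) (hu : IsNegligible Ω u) :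
    IsNegligible Ω (fun ε x => u ε (r • x)) := by
  refine ⟨fun ε => (hu.1 ε).comp (contDiff_const_smul r).contDiffOn hr,
    fun K hK hKΩ w m => ?_⟩
  obtain ⟨C, η, hη, H⟩ := hu.2 ((fun x => r • x) '' K) (hK.image (continuous_const_smul r))
    (by rintro _ ⟨x, hx, rfl⟩; exact hr x (hKΩ hx)) w m
  refine IsBigOOn.congr (fun ε x _ => ?_)
    (IsBigOOn.smul ((r : ℂ) ^ w.length)
      (u := fun ε x => iterPartial w (u ε) (r • x))
      ⟨C, η, hη, fun ε hε x hx => H ε hε _ ⟨x, hx, rfl⟩⟩)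
  simp only [iterPartial_dilate]
  rfl

end Growth

/-! ### The special Colombeau algebra -/

/-- The algebra `E_M(Ω)` of moderate nets, with componentwise operations. -/
def Moderate (Ω : Opens (Space d)) : Subalgebra ℂ (Net d) where
  carrier := {u | IsModerate Ω u}
  add_mem' hu hv := IsModerate.add hu hv
  mul_mem' hu hv := IsModerate.mul hu hv
  algebraMap_mem' c := isModerate_of_smooth (f := fun _ => c) contDiffOn_const

/-- The ideal `N(Ω)` of negligible nets in `E_M(Ω)`. -/
def Negligible (Ω : Opens (Space d)) : Ideal (Moderate Ω) where
  carrier := {u | IsNegligible Ω (u : Net d)}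
  add_mem' hu hv := IsNegligible.add hu hv
  zero_mem' := isNegligible_zero
  smul_mem' u _ hv := IsModerate.mul_isNegligible u.2 hv

/-- The special Colombeau algebra `G(Ω) = E_M(Ω) / N(Ω)`. -/
abbrev GenFun (Ω : Opens (Space d)) : Type := Moderate Ω ⧸ Negligible Ω

/-- The class in `G(Ω)` of a moderate net. -/
def mk {Ω : Opens (Space d)} (u : Net d) (hu : IsModerate Ω u) : GenFun Ω :=
  Ideal.Quotient.mk (Negligible Ω) ⟨u, hu⟩

theorem mk_eq_mk {Ω : Opens (Space d)} {u v : Net d} (hu : IsModerate Ω u)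
    (hv : IsModerate Ω v) : mk u hu = mk v hv ↔ IsNegligible Ω (u - v) :=
  Ideal.Quotient.mk_eq_mk_iff_sub_mem _ _

variable {Ω : Opens (Space d)}

/-- The coordinate function `x_i` as an element of `G(Ω)`. -/
def coord (i : Fin d) : GenFun Ω :=
  mk (fun _ x => ((x i : ℝ) : ℂ))
    (isModerate_of_smooth (Complex.ofRealCLM.contDiff.comp
      (EuclideanSpace.proj (𝕜 := ℝ) i).contDiff).contDiffOn)

/-- The partial derivative `∂u/∂x_i` of `u ∈ G(Ω)`, componentwise on representatives. -/
def pderiv (i : Fin d) (u : GenFun Ω) : GenFun Ω :=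
  Quotient.liftOn' u (fun v => mk (fun ε => partialDeriv i ((v : Net d) ε)) (v.2.partialDeriv i))
    (fun v w h => by
      have h' : IsNegligible Ω ((v : Net d) - (w : Net d)) := (Submodule.quotientRel_def _).1 h
      refine (mk_eq_mk _ _).2 ?_
      have hn := h'.partialDeriv i
      refine ⟨fun ε => (contDiffOn_partialDeriv (v.2.1 ε) i).sub
        (contDiffOn_partialDeriv (w.2.1 ε) i), fun K hK hKΩ l m =>
          (hn.2 K hK hKΩ l m).congr fun ε => (iterPartial_congr l ?_).mono hKΩ⟩
      intro x hx
      simp only [partialDeriv, Pi.sub_apply]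
      rw [fderiv_sub (differentiableAt_of_smooth (v.2.1 ε) hx)
        (differentiableAt_of_smooth (w.2.1 ε) hx)]
      rfl)

theorem pderiv_mk (i : Fin d) {u : Net d} (hu : IsModerate Ω u) :
    pderiv i (mk u hu) = mk (fun ε => partialDeriv i (u ε)) (hu.partialDeriv i) := rfl

/-- `Ω` is stable under the dilations `x ↦ λx`, `λ > 0`. -/
def IsConic (Ω : Opens (Space d)) : Prop :=
  ∀ r : ℝ, 0 < r → ∀ x ∈ Ω, r • x ∈ Ω

/-- The dilated generalized function `x ↦ u(λx)`, componentwise on representatives. -/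
def dilate (hΩ : IsConic Ω) (r : ℝ) (hr : 0 < r) (u : GenFun Ω) : GenFun Ω :=
  Quotient.liftOn' u
    (fun v => mk (fun ε x => (v : Net d) ε (r • x)) (isModerate_dilate (hΩ r hr) v.2))
    (fun v w h => by
      have h' : IsNegligible Ω ((v : Net d) - (w : Net d)) := (Submodule.quotientRel_def _).1 h
      exact (mk_eq_mk _ _).2 (isNegligible_dilate (hΩ r hr) h'))

theorem dilate_mk (hΩ : IsConic Ω) (r : ℝ) (hr : 0 < r) {u : Net d} (hu : IsModerate Ω u) :
    dilate hΩ r hr (mk u hu) =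
      mk (fun ε x => u ε (r • x)) (isModerate_dilate (hΩ r hr) hu) := rfl

/-- `u` satisfies the Euler equation `∑ x_i ∂u/∂x_i = α u` in `G(Ω)`. -/
def SatisfiesEuler (α : ℝ) (u : GenFun Ω) : Prop :=
  ∑ i : Fin d, coord i * pderiv i u = (α : ℂ) • u

/-- `u` is homogeneous of degree `α`: for each real `λ > 0`, `u(λx) = λ^α u(x)` in `G(Ω)`. -/
def IsHomogeneous (hΩ : IsConic Ω) (α : ℝ) (u : GenFun Ω) : Prop :=
  ∀ (r : ℝ) (hr : 0 < r), dilate hΩ r hr u = ((r ^ α : ℝ) : ℂ) • u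

/-- The open set `ℝ^d`. -/
def whole (d : ℕ) : Opens (Space d) := ⊤

/-- The open set `ℝ^d ∖ {0}`. -/
def punctured (d : ℕ) : Opens (Space d) := ⟨{0}ᶜ, isOpen_compl_singleton⟩

theorem isConic_whole (d : ℕ) : IsConic (whole d) := fun _ _ _ _ => trivial

theorem isConic_punctured (d : ℕ) : IsConic (punctured d) := fun _ hr _ hx =>
  smul_ne_zero hr.ne' hx

end Colombeau

end

/-!
The operator `E = ∑ x_i ∂_i - α` generates the weighted dilations `(T_s f)(x) = e^{-αs} f(e^s x)`,
and `u` is homogeneous of degree `α` if and only if `T_s u = u` in the Colombeau algebra for all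
`s`. By the mean value inequality along orbits, `T_s u - u` is negligible when `E u` is.

Conversely, if every `T_s u - u` is negligible, Baire's theorem makes the estimate uniform for `s`
in some interval. There `T_s u` is nearly constant in `s` while its second derivative `T_s E² u`
grows at most like a power of `1/ε`, so Landau's inequality bounding a first derivative through the
function and its second derivative makes `T_s E u` small. The same inequality along coordinate
lines shows that a moderate net is negligible once it satisfies the estimates of order zero, hence
no derivatives need to be estimated in either direction.
-/

namespace Colombeau

section Landau

variable {E : Type*} [NormedAddCommGroup E] [NormedSpace ℝ E] {g g' g'' : ℝ → E} {c : E} {a : ℝ}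

theorem mul_norm_deriv_le_of_norm_sub_le {τ A M : ℝ} (hτ : 0 ≤ τ)
    (hg : ∀ t ∈ Set.Icc a (a + τ), HasDerivAt g (g' t) t)
    (hg' : ∀ t ∈ Set.Icc a (a + τ), HasDerivAt g' (g'' t) t)
    (hA : ∀ t ∈ Set.Icc a (a + τ), ‖g t - c‖ ≤ A)
    (hM : ∀ t ∈ Set.Icc a (a + τ), ‖g'' t‖ ≤ M) :
    τ * ‖g' a‖ ≤ 2 * A + M * τ ^ 2 := by
  have left_mem : a ∈ Set.Icc a (a + τ) := ⟨le_rfl, by linarith⟩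
  have right_mem : a + τ ∈ Set.Icc a (a + τ) := ⟨by linarith, le_rfl⟩
  have M_nonneg : 0 ≤ M := (norm_nonneg _).trans (hM a left_mem)
  have deriv_sub_le : ∀ t ∈ Set.Icc a (a + τ), ‖g' t - g' a‖ ≤ M * τ := fun t ht =>
    (norm_image_sub_le_of_norm_deriv_le_segment' (fun s hs => (hg' s hs).hasDerivWithinAt)
      (fun s hs => hM s (Set.Ico_subset_Icc_self hs)) t ht).trans
      (mul_le_mul_of_nonneg_left (by linarith [ht.2]) M_nonneg)
  have taylor : ‖(g (a + τ) - (a + τ) • g' a) - (g a - a • g' a)‖ ≤ M * τ * (a + τ - a) :=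
    norm_image_sub_le_of_norm_deriv_le_segment'
      (fun s hs => ((hg s hs).sub ((hasDerivAt_id s).smul_const (g' a))).hasDerivWithinAt)
      (fun s hs => by
        simpa only [one_smul] using deriv_sub_le s (Set.Ico_subset_Icc_self hs)) _ right_mem
  calc τ * ‖g' a‖ = ‖τ • g' a‖ := by rw [norm_smul, Real.norm_of_nonneg hτ]
    _ = ‖(g (a + τ) - c) - (g a - c) -
          ((g (a + τ) - (a + τ) • g' a) - (g a - a • g' a))‖ := by
      congr 1
      module
    _ ≤ A + A + M * τ * (a + τ - a) :=
      norm_sub_le_of_le (norm_sub_le_of_le (hA _ right_mem) (hA _ left_mem)) taylor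
    _ = 2 * A + M * τ ^ 2 := by ring

theorem norm_deriv_le_mul_zpow {δ ε C₁ C₂ : ℝ} {N m : ℕ} (hδ : 0 < δ) (hε : 0 < ε)
    (hε_le : ε ≤ 1)
    (hg : ∀ t ∈ Set.Icc a (a + δ), HasDerivAt g (g' t) t)
    (hg' : ∀ t ∈ Set.Icc a (a + δ), HasDerivAt g' (g'' t) t)
    (hC₁ : ∀ t ∈ Set.Icc a (a + δ), ‖g t - c‖ ≤ C₁ * ε ^ ((N + 2 * m : ℕ) : ℤ))
    (hC₂ : ∀ t ∈ Set.Icc a (a + δ), ‖g'' t‖ ≤ C₂ * ε ^ (-(N : ℤ))) :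
    ‖g' a‖ ≤ (2 * C₁ / δ + C₂ * δ) * ε ^ (m : ℤ) := by
  -- This step balances the two terms of the Landau inequality.
  set τ : ℝ := δ * ε ^ (N + m) with hτ
  have τ_pos : 0 < τ := by positivity
  have τ_le : τ ≤ δ := mul_le_of_le_one_right hδ.le (pow_le_one₀ hε.le hε_le)
  have Icc_subset : Set.Icc a (a + τ) ⊆ Set.Icc a (a + δ) :=
    Set.Icc_subset_Icc_right (by linarith)
  have landau := mul_norm_deriv_le_of_norm_sub_le τ_pos.le
    (fun t ht => hg t (Icc_subset ht)) (fun t ht => hg' t (Icc_subset ht))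
    (fun t ht => hC₁ t (Icc_subset ht)) (fun t ht => hC₂ t (Icc_subset ht))
  refine le_of_mul_le_mul_left (landau.trans_eq ?_) τ_pos
  rw [hτ, zpow_neg, zpow_natCast, zpow_natCast, zpow_natCast]
  field_simp
  ring

end Landau

section WeightedDilation

variable {E F : Type*} [NormedAddCommGroup E] [NormedSpace ℝ E] [NormedAddCommGroup F]
  [NormedSpace ℝ F] {f : E → F} {x : E} {α s A : ℝ}

/-- The weighted dilations `(T_s f)(x) = e^{-αs} f(e^s x)`. They form a one-parameter group in `s`
whose fixed points are the functions that are homogeneous of degree `α`. -/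
noncomputable def weightedDilation (α s : ℝ) (f : E → F) : E → F :=
  fun x => Real.exp (-(α * s)) • f (Real.exp s • x)

/-- The Euler operator `f ↦ ∑ x_i ∂f/∂x_i - α f`, with the sum written as the derivative of `f` at
`x` in the direction `x`. It generates the weighted dilations `T_s`. -/
noncomputable def eulerOp (α : ℝ) (f : E → F) : E → F :=
  fun x => fderiv ℝ f x x - α • f x

theorem hasDerivAt_weightedDilation (α : ℝ) (hf : DifferentiableAt ℝ f (Real.exp s • x)) :
    HasDerivAt (fun t => weightedDilation α t f x) (weightedDilation α s (eulerOp α f) x) s := by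
  have hdilate : HasDerivAt (fun t => f (Real.exp t • x))
      (fderiv ℝ f (Real.exp s • x) (Real.exp s • x)) s :=
    hf.hasFDerivAt.comp_hasDerivAt s ((Real.hasDerivAt_exp s).smul_const x)
  have hweight : HasDerivAt (fun t => Real.exp (-(α * t))) (Real.exp (-(α * s)) * -α) s := by
    simpa using ((hasDerivAt_id s).const_mul α).neg.exp
  refine (hweight.smul hdilate).congr_deriv ?_
  simp only [weightedDilation, eulerOp]
  module

theorem weightedDilation_zero (α : ℝ) (f : E → F) : weightedDilation α 0 f = f := by
  funext x
  simp [weightedDilation]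

theorem weightedDilation_exp_neg_smul (α s : ℝ) (f : E → F) (x : E) :
    weightedDilation α s f (Real.exp (-s) • x) = Real.exp (-(α * s)) • f x := by
  rw [weightedDilation, smul_smul, ← Real.exp_add, add_neg_cancel, Real.exp_zero, one_smul]

theorem norm_weightedDilation_le {B : ℝ} (hs : |s| ≤ B) (hA : ‖f (Real.exp s • x)‖ ≤ A) :
    ‖weightedDilation α s f x‖ ≤ Real.exp (|α| * B) * A := by
  rw [weightedDilation, norm_smul, Real.norm_of_nonneg (Real.exp_pos _).le]
  have exponent_le : -(α * s) ≤ |α| * B :=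
    calc -(α * s) ≤ |α * s| := neg_le_abs _
      _ = |α| * |s| := abs_mul α s
      _ ≤ |α| * B := by gcongr
  gcongr

theorem norm_weightedDilation_sub_le
    (hf : ∀ t ∈ Set.uIcc 0 s, DifferentiableAt ℝ f (Real.exp t • x))
    (hA : ∀ t ∈ Set.uIcc 0 s, ‖eulerOp α f (Real.exp t • x)‖ ≤ A) :
    ‖weightedDilation α s f x - f x‖ ≤ Real.exp (|α| * |s|) * A * |s| := by
  have mean_value := (convex_uIcc 0 s).norm_image_sub_le_of_norm_hasDerivWithin_le
    (fun t ht => (hasDerivAt_weightedDilation α (hf t ht)).hasDerivWithinAt)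
    (fun t ht => norm_weightedDilation_le
      (by simpa using Set.abs_sub_left_of_mem_uIcc ht) (hA t ht))
    Set.left_mem_uIcc Set.right_mem_uIcc
  simpa only [weightedDilation_zero, sub_zero, Real.norm_eq_abs] using mean_value

theorem norm_weightedDilation_eulerOp_le {a B δ ε C₁ C₂ : ℝ} {N m : ℕ} (hδ : 0 < δ) (hε : 0 < ε)
    (hε_le : ε ≤ 1) (hB : ∀ t ∈ Set.Icc a (a + δ), |t| ≤ B)
    (hf : ∀ t ∈ Set.Icc a (a + δ), DifferentiableAt ℝ f (Real.exp t • x))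
    (hEf : ∀ t ∈ Set.Icc a (a + δ), DifferentiableAt ℝ (eulerOp α f) (Real.exp t • x))
    (hC₁ : ∀ t ∈ Set.Icc a (a + δ),
      ‖weightedDilation α t f x - f x‖ ≤ C₁ * ε ^ ((N + 2 * m : ℕ) : ℤ))
    (hC₂ : ∀ t ∈ Set.Icc a (a + δ),
      ‖eulerOp α (eulerOp α f) (Real.exp t • x)‖ ≤ C₂ * ε ^ (-(N : ℤ))) :
    ‖weightedDilation α a (eulerOp α f) x‖ ≤
      (2 * C₁ / δ + Real.exp (|α| * B) * C₂ * δ) * ε ^ (m : ℤ) :=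
  norm_deriv_le_mul_zpow hδ hε hε_le
    (fun t ht => hasDerivAt_weightedDilation α (hf t ht))
    (fun t ht => hasDerivAt_weightedDilation α (hEf t ht)) hC₁
    (fun t ht => (norm_weightedDilation_le (hB t ht) (hC₂ t ht)).trans_eq (mul_assoc _ _ _).symm)

end WeightedDilation

variable {d : ℕ} {Ω : Opens (Space d)} {K : Set (Space d)} {u : Net d} {α : ℝ}

section ZerothOrder

theorem hasDerivAt_add_smul_single {f : Space d → ℂ} {x : Space d} {t : ℝ} (i : Fin d)
    (hf : DifferentiableAt ℝ f (x + t • EuclideanSpace.single i 1)) :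
    HasDerivAt (fun s : ℝ => f (x + s • EuclideanSpace.single i 1))
      (partialDeriv i f (x + t • EuclideanSpace.single i 1)) t := by
  have hline : HasDerivAt (fun s : ℝ => x + s • EuclideanSpace.single i (1 : ℝ))
      (EuclideanSpace.single i 1) t := by
    simpa using ((hasDerivAt_id t).smul_const (EuclideanSpace.single i (1 : ℝ))).const_add x
  exact hf.hasFDerivAt.comp_hasDerivAt t hline

theorem add_smul_single_mem_cthickening {x : Space d} (hx : x ∈ K) (i : Fin d) {t δ : ℝ}
    (ht : t ∈ Set.Icc 0 δ) : x + t • EuclideanSpace.single i (1 : ℝ) ∈ Metric.cthickening δ K :=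
  Metric.mem_cthickening_of_dist_le _ x δ K hx <| by
    simpa [norm_smul, abs_of_nonneg ht.1] using ht.2

theorem IsModerate.isBigOOn_partialDeriv (hu : IsModerate Ω u)
    (hu₀ : ∀ K : Set (Space d), IsCompact K → K ⊆ Ω → ∀ m : ℕ, IsBigOOn K u m)
    (i : Fin d) (hK : IsCompact K) (hKΩ : K ⊆ Ω) (m : ℕ) :
    IsBigOOn K (fun ε => Colombeau.partialDeriv i (u ε)) m := by
  obtain ⟨δ, δ_pos, hδΩ⟩ := hK.exists_cthickening_subset_open Ω.isOpen hKΩ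
  obtain ⟨N, C₂, η₂, η₂_pos, bound₂⟩ := hu.2 _ hK.cthickening hδΩ [i, i]
  obtain ⟨C₁, η₁, η₁_pos, bound₁⟩ := hu₀ _ hK.cthickening hδΩ (N + 2 * m)
  refine ⟨2 * C₁ / δ + C₂ * δ, min η₁ η₂, lt_min η₁_pos η₂_pos, fun ε hε x hx => ?_⟩
  obtain ⟨hε₁, hε₂⟩ := lt_min_iff.1 hε
  have segment_mem : ∀ t ∈ Set.Icc 0 (0 + δ),
      x + t • EuclideanSpace.single i (1 : ℝ) ∈ Metric.cthickening δ K := fun t ht =>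
    add_smul_single_mem_cthickening hx i (by simpa only [zero_add] using ht)
  have landau := norm_deriv_le_mul_zpow (c := 0) (N := N) (m := m) δ_pos ε.2.1 ε.2.2
    (fun t ht => hasDerivAt_add_smul_single i
      (differentiableAt_of_smooth (hu.1 ε) (hδΩ (segment_mem t ht))))
    (fun t ht => hasDerivAt_add_smul_single i
      (differentiableAt_of_smooth ((hu.partialDeriv i).1 ε) (hδΩ (segment_mem t ht))))
    (fun t ht => by simpa only [sub_zero] using bound₁ ε hε₁ _ (segment_mem t ht))
    (fun t ht => bound₂ ε hε₂ _ (segment_mem t ht))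
  simpa only [zero_smul, add_zero] using landau

theorem IsModerate.isNegligible (hu : IsModerate Ω u)
    (hu₀ : ∀ K : Set (Space d), IsCompact K → K ⊆ Ω → ∀ m : ℕ, IsBigOOn K u m) :
    IsNegligible Ω u := by
  refine ⟨hu.1, fun K hK hKΩ w => ?_⟩
  induction w generalizing u with
  | nil => exact hu₀ K hK hKΩ
  | cons i _ ih =>
    exact ih (hu.partialDeriv i) fun K hK hKΩ => hu.isBigOOn_partialDeriv hu₀ i hK hKΩ

end ZerothOrder

section Moderateness

theorem isModerate_coord (i : Fin d) : IsModerate Ω fun _ x => ((x i : ℝ) : ℂ) :=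
  isModerate_of_smooth
    (Complex.ofRealCLM.contDiff.comp (EuclideanSpace.proj (𝕜 := ℝ) i).contDiff).contDiffOn

theorem fderiv_apply_eq_sum_partialDeriv (f : Space d → ℂ) (x v : Space d) :
    fderiv ℝ f x v = ∑ i, ((v i : ℝ) : ℂ) * partialDeriv i f x := by
  have sum_repr : ∑ i, v i • EuclideanSpace.single i (1 : ℝ) = v := by
    simpa using (EuclideanSpace.basisFun (Fin d) ℝ).sum_repr v
  calc fderiv ℝ f x v = fderiv ℝ f x (∑ i, v i • EuclideanSpace.single i 1) := by rw [sum_repr]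
    _ = ∑ i, ((v i : ℝ) : ℂ) * partialDeriv i f x := by
      simp only [map_sum, map_smul, Complex.real_smul, partialDeriv]

theorem eulerOp_net_eq (α : ℝ) (u : Net d) :
    (fun ε => eulerOp α (u ε)) =
      ∑ i, (fun _ x => ((x i : ℝ) : ℂ)) * (fun ε => partialDeriv i (u ε)) - (α : ℂ) • u := by
  funext ε x
  simp [eulerOp, fderiv_apply_eq_sum_partialDeriv, Finset.sum_apply]

theorem weightedDilation_net_eq (α s : ℝ) (u : Net d) :
    (fun ε => weightedDilation α s (u ε)) =
      ((Real.exp (-(α * s)) : ℝ) : ℂ) • fun ε x => u ε (Real.exp s • x) := by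
  funext ε x
  simp only [weightedDilation, Pi.smul_apply, Complex.coe_smul]

theorem IsModerate.eulerOp (α : ℝ) (hu : IsModerate Ω u) :
    IsModerate Ω fun ε => eulerOp α (u ε) := by
  rw [eulerOp_net_eq]
  exact (Moderate Ω).sub_mem
    ((Moderate Ω).sum_mem fun i _ => (isModerate_coord i).mul (hu.partialDeriv i))
    ((Moderate Ω).smul_mem hu _)

theorem IsModerate.weightedDilation (hΩ : IsConic Ω) (α s : ℝ) (hu : IsModerate Ω u) :
    IsModerate Ω fun ε => weightedDilation α s (u ε) := by
  rw [weightedDilation_net_eq]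
  exact (Moderate Ω).smul_mem (isModerate_dilate (hΩ _ (Real.exp_pos s)) hu) _

end Moderateness

open scoped Pointwise

theorem IsConic.exp_image_smul_subset (hΩ : IsConic Ω) (S : Set ℝ) (hKΩ : K ⊆ Ω) :
    (Real.exp '' S) • K ⊆ (Ω : Set (Space d)) := by
  rintro _ ⟨_, ⟨s, -, rfl⟩, x, hx, rfl⟩
  exact hΩ _ (Real.exp_pos s) x (hKΩ hx)

section EulerToHomogeneous

theorem isBigOOn_weightedDilation_sub (hΩ : IsConic Ω) (hu : IsSmoothNet Ω u)
    (hEu : IsNegligible Ω fun ε => eulerOp α (u ε)) (s : ℝ) (hK : IsCompact K) (hKΩ : K ⊆ Ω)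
    (m : ℕ) : IsBigOOn K (fun ε => weightedDilation α s (u ε) - u ε) m := by
  have dilates_subset := hΩ.exp_image_smul_subset (Set.uIcc 0 s) hKΩ
  obtain ⟨C, η, η_pos, bound⟩ :=
    hEu.2 _ ((isCompact_uIcc.image Real.continuous_exp).smul_set hK) dilates_subset [] m
  refine ⟨Real.exp (|α| * |s|) * C * |s|, η, η_pos, fun ε hε x hx => ?_⟩
  calc ‖weightedDilation α s (u ε) x - u ε x‖
      ≤ Real.exp (|α| * |s|) * (C * (ε : ℝ) ^ (m : ℤ)) * |s| :=
        norm_weightedDilation_sub_le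
          (fun t ht => differentiableAt_of_smooth (hu ε)
            (dilates_subset (Set.smul_mem_smul ⟨t, ht, rfl⟩ hx)))
          (fun t ht => bound ε hε _ (Set.smul_mem_smul ⟨t, ht, rfl⟩ hx))
    _ = Real.exp (|α| * |s|) * C * |s| * (ε : ℝ) ^ (m : ℤ) := by ring

theorem isNegligible_weightedDilation_sub (hΩ : IsConic Ω) (hu : IsModerate Ω u)
    (hEu : IsNegligible Ω fun ε => eulerOp α (u ε)) (s : ℝ) :
    IsNegligible Ω fun ε => weightedDilation α s (u ε) - u ε :=
  IsModerate.isNegligible ((Moderate Ω).sub_mem (hu.weightedDilation hΩ α s) hu)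
    fun _ hK hKΩ => isBigOOn_weightedDilation_sub hΩ hu.1 hEu s hK hKΩ

end EulerToHomogeneous

section HomogeneousToEuler

theorem IsBigOOn.exists_nat_bound {r : ℤ} (hu : IsBigOOn K u r) :
    ∃ k : ℕ, ∀ ε : Param, (ε : ℝ) < 1 / (k + 1) → ∀ x ∈ K, ‖u ε x‖ ≤ k * (ε : ℝ) ^ r := by
  obtain ⟨C, η, η_pos, bound⟩ := hu
  obtain ⟨k₁, hk₁⟩ := exists_nat_ge C
  obtain ⟨k₂, hk₂⟩ := exists_nat_one_div_lt η_pos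
  refine ⟨max k₁ k₂, fun ε hε x hx => (bound ε (hε.trans_le ?_) x hx).trans ?_⟩
  · refine (one_div_le_one_div_of_le (by positivity) ?_).trans hk₂.le
    gcongr
    exact le_max_right _ _
  · refine mul_le_mul_of_nonneg_right (hk₁.trans ?_) (zpow_nonneg ε.2.1.le r)
    exact_mod_cast le_max_left _ _

/-- The sets of parameters that share the bound `k * ε ^ r` for `ε < 1 / (k + 1)` are closed and
cover `S`, so that Baire's theorem applies. -/
theorem exists_isOpen_uniform_isBigOOn {X : Type*} [TopologicalSpace X] [BaireSpace X] {S : Set X}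
    (hS : IsOpen S) (hne : S.Nonempty) {F : X → Net d} {r : ℤ}
    (hcont : ∀ ε, ∀ x ∈ K, Continuous fun s => F s ε x) (hF : ∀ s ∈ S, IsBigOOn K (F s) r) :
    ∃ U ⊆ S, IsOpen U ∧ U.Nonempty ∧ ∃ C η : ℝ, 0 < η ∧
      ∀ s ∈ U, ∀ ε : Param, (ε : ℝ) < η → ∀ x ∈ K, ‖F s ε x‖ ≤ C * (ε : ℝ) ^ r := by
  let A : ℕ → Set X := fun k =>
    {s | ∀ ε : Param, (ε : ℝ) < 1 / (k + 1) → ∀ x ∈ K, ‖F s ε x‖ ≤ k * (ε : ℝ) ^ r}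
  have isClosed_A : ∀ k, IsClosed (A k) := fun k => by
    simp only [A, Set.ofPred_forall]
    exact isClosed_iInter fun ε => isClosed_iInter fun _ => isClosed_iInter fun x =>
      isClosed_iInter fun hx => isClosed_le (hcont ε x hx).norm continuous_const
  have cover : ⋃ k, (Sᶜ ∪ A k) = Set.univ := by
    refine Set.eq_univ_of_forall fun s => Set.mem_iUnion.2 ?_
    by_cases hs : s ∈ S
    · exact (hF s hs).exists_nat_bound.imp fun k hk => Or.inr hk
    · exact ⟨0, Or.inl hs⟩
  obtain ⟨s, hsS, hs⟩ := (dense_iUnion_interior_of_closed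
    (fun k => hS.isClosed_compl.union (isClosed_A k)) cover).inter_open_nonempty S hS hne
  obtain ⟨k, hsk⟩ := Set.mem_iUnion.1 hs
  exact ⟨S ∩ interior (Sᶜ ∪ A k), Set.inter_subset_left, hS.inter isOpen_interior, ⟨s, hsS, hsk⟩,
    k, 1 / (k + 1), by positivity,
    fun t ht => (interior_subset ht.2).resolve_left (not_not_intro ht.1)⟩

theorem exists_Icc_uniform_bound_weightedDilation_sub (hΩ : IsConic Ω) (hu : IsSmoothNet Ω u)
    (hKΩ : K ⊆ Ω) {r : ℤ}
    (hT : ∀ s ∈ Set.Ioo 0 1, IsBigOOn K (fun ε => weightedDilation α s (u ε) - u ε) r) :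
    ∃ a δ : ℝ, 0 < δ ∧ Set.Icc a (a + δ) ⊆ Set.Icc 0 1 ∧ ∃ C η : ℝ, 0 < η ∧
      ∀ s ∈ Set.Icc a (a + δ), ∀ ε : Param, (ε : ℝ) < η → ∀ x ∈ K,
        ‖weightedDilation α s (u ε) x - u ε x‖ ≤ C * (ε : ℝ) ^ r := by
  have hcont : ∀ ε, ∀ x ∈ K, Continuous fun s => weightedDilation α s (u ε) x - u ε x :=
    fun ε x hx => (continuous_iff_continuousAt.2 fun s => (hasDerivAt_weightedDilation α
      (differentiableAt_of_smooth (hu ε) (hΩ _ (Real.exp_pos s) x (hKΩ hx)))).continuousAt).sub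
        continuous_const
  obtain ⟨U, hU_subset, hU_open, ⟨a, ha⟩, C, η, η_pos, bound⟩ := exists_isOpen_uniform_isBigOOn
    isOpen_Ioo (Set.nonempty_Ioo.2 zero_lt_one) hcont hT
  obtain ⟨δ, δ_pos, hδ⟩ := Metric.nhds_basis_closedBall.mem_iff.1 (hU_open.mem_nhds ha)
  have Icc_subset : Set.Icc a (a + δ) ⊆ U := by
    refine subset_trans ?_ hδ
    rw [Real.closedBall_eq_Icc]
    exact Set.Icc_subset_Icc_left (by linarith)
  exact ⟨a, δ, δ_pos, Icc_subset.trans (hU_subset.trans Set.Ioo_subset_Icc_self), C, η, η_pos,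
    fun s hs => bound s (Icc_subset hs)⟩

theorem isBigOOn_eulerOp (hΩ : IsConic Ω) (hu : IsModerate Ω u)
    (hT : ∀ s, IsNegligible Ω fun ε => weightedDilation α s (u ε) - u ε) (hK : IsCompact K)
    (hKΩ : K ⊆ Ω) (m : ℕ) : IsBigOOn K (fun ε => eulerOp α (u ε)) m := by
  -- `L` contains `e^{-a} K` for every base point `a` that Baire's theorem may return.
  set L : Set (Space d) := (Real.exp '' Set.Icc (-1) 0) • K
  have hL : IsCompact L := (isCompact_Icc.image Real.continuous_exp).smul_set hK
  have hLΩ : L ⊆ Ω := hΩ.exp_image_smul_subset _ hKΩ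
  obtain ⟨N, C₂, η₂, η₂_pos, bound₂⟩ := ((hu.eulerOp α).eulerOp α).2 _
    ((isCompact_Icc.image Real.continuous_exp).smul_set hL)
    (hΩ.exp_image_smul_subset (Set.Icc 0 1) hLΩ) []
  obtain ⟨a, δ, δ_pos, Icc_subset, C₁, η₁, η₁_pos, bound₁⟩ :=
    exists_Icc_uniform_bound_weightedDilation_sub hΩ hu.1 hLΩ
      fun s _ => (hT s).2 L hL hLΩ [] (N + 2 * m)
  have a_mem : a ∈ Set.Icc 0 1 := Icc_subset ⟨le_rfl, by linarith⟩
  have scaled : IsBigOOn K (fun ε => Real.exp (-(α * a)) • eulerOp α (u ε)) m := by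
    refine ⟨2 * C₁ / δ + Real.exp (|α| * 1) * C₂ * δ, min η₁ η₂, lt_min η₁_pos η₂_pos,
      fun ε hε y hy => ?_⟩
    obtain ⟨hε₁, hε₂⟩ := lt_min_iff.1 hε
    have hx : Real.exp (-a) • y ∈ L :=
      Set.smul_mem_smul ⟨-a, ⟨by linarith [a_mem.2], by linarith [a_mem.1]⟩, rfl⟩ hy
    have orbit_mem : ∀ t, Real.exp t • Real.exp (-a) • y ∈ Ω := fun t =>
      hΩ _ (Real.exp_pos t) _ (hLΩ hx)
    have landau := norm_weightedDilation_eulerOp_le δ_pos ε.2.1 ε.2.2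
      (fun t ht => abs_le.2 ⟨by linarith [(Icc_subset ht).1], (Icc_subset ht).2⟩)
      (fun t _ => differentiableAt_of_smooth (hu.1 ε) (orbit_mem t))
      (fun t _ => differentiableAt_of_smooth ((hu.eulerOp α).1 ε) (orbit_mem t))
      (fun t ht => bound₁ t ht ε hε₁ _ hx)
      (fun t ht => bound₂ ε hε₂ _ (Set.smul_mem_smul ⟨t, Icc_subset ht, rfl⟩ hx))
    rwa [weightedDilation_exp_neg_smul] at landau
  refine (scaled.smul ((Real.exp (α * a) : ℝ) : ℂ)).congr fun ε x _ => ?_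
  simp only [Pi.smul_apply, Complex.coe_smul, smul_smul, ← Real.exp_add, add_neg_cancel,
    Real.exp_zero, one_smul]

theorem isNegligible_eulerOp (hΩ : IsConic Ω) (hu : IsModerate Ω u)
    (hT : ∀ s, IsNegligible Ω fun ε => weightedDilation α s (u ε) - u ε) :
    IsNegligible Ω fun ε => eulerOp α (u ε) :=
  (hu.eulerOp α).isNegligible fun _ hK hKΩ => isBigOOn_eulerOp hΩ hu hT hK hKΩ

end HomogeneousToEuler

section Quotient

theorem mk_eq_zero_iff (hu : IsModerate Ω u) : mk u hu = 0 ↔ IsNegligible Ω u :=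
  Ideal.Quotient.eq_zero_iff_mem

theorem mk_eulerOp (α : ℝ) (hu : IsModerate Ω u) :
    mk (fun ε => eulerOp α (u ε)) (hu.eulerOp α) =
      ∑ i, coord i * pderiv i (mk u hu) - (α : ℂ) • mk u hu := by
  let D : Fin d → Moderate Ω := fun i => ⟨_, (isModerate_coord i).mul (hu.partialDeriv i)⟩
  have eulerOp_eq : (⟨fun ε => eulerOp α (u ε), hu.eulerOp α⟩ : Moderate Ω) =
      ∑ i, D i - (α : ℂ) • ⟨u, hu⟩ :=
    Subtype.ext <| by simp [eulerOp_net_eq, D]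
  calc _ = Ideal.Quotient.mk (Negligible Ω) (∑ i, D i - (α : ℂ) • ⟨u, hu⟩) :=
        congrArg (Ideal.Quotient.mk (Negligible Ω)) eulerOp_eq
    _ = ∑ i, Ideal.Quotient.mk (Negligible Ω) (D i) - (α : ℂ) • mk u hu :=
        congrArg (· - (α : ℂ) • mk u hu) (map_sum (Ideal.Quotient.mk (Negligible Ω)) D Finset.univ)
    _ = _ := rfl

theorem satisfiesEuler_mk_iff (hu : IsModerate Ω u) :
    SatisfiesEuler α (mk u hu) ↔ IsNegligible Ω fun ε => eulerOp α (u ε) := by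
  rw [SatisfiesEuler, ← sub_eq_zero, ← mk_eulerOp, mk_eq_zero_iff]

theorem mk_weightedDilation (hΩ : IsConic Ω) (α s : ℝ) (hu : IsModerate Ω u) :
    mk (fun ε => weightedDilation α s (u ε)) (hu.weightedDilation hΩ α s) =
      ((Real.exp (-(α * s)) : ℝ) : ℂ) • dilate hΩ (Real.exp s) (Real.exp_pos s) (mk u hu) := by
  simp only [weightedDilation_net_eq]
  rfl

theorem isHomogeneous_mk_iff (hΩ : IsConic Ω) (hu : IsModerate Ω u) :
    IsHomogeneous hΩ α (mk u hu) ↔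
      ∀ s, IsNegligible Ω fun ε => weightedDilation α s (u ε) - u ε := by
  have fixed_iff : ∀ s, IsNegligible Ω (fun ε => weightedDilation α s (u ε) - u ε) ↔
      dilate hΩ (Real.exp s) (Real.exp_pos s) (mk u hu) =
        ((Real.exp s ^ α : ℝ) : ℂ) • mk u hu := fun s => by
    have weight_eq : ((Real.exp (-(α * s)) : ℝ) : ℂ) = ((Real.exp s ^ α : ℝ) : ℂ)⁻¹ := by
      rw [← Real.exp_mul, Real.exp_neg, Complex.ofReal_inv, mul_comm]
    have weight_ne_zero : ((Real.exp s ^ α : ℝ) : ℂ) ≠ 0 :=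
      Complex.ofReal_ne_zero.2 (Real.rpow_pos_of_pos (Real.exp_pos s) α).ne'
    rw [← inv_smul_eq_iff₀ weight_ne_zero, ← weight_eq, ← mk_weightedDilation]
    exact (mk_eq_mk (hu.weightedDilation hΩ α s) hu).symm
  simp only [fixed_iff]
  exact ⟨fun h s => h _ (Real.exp_pos s), fun h r hr => by
    simpa only [Real.exp_log hr] using h (Real.log r)⟩

theorem exists_mk_eq (u : GenFun Ω) : ∃ (v : Net d) (hv : IsModerate Ω v), mk v hv = u :=
  let ⟨v, hv⟩ := Ideal.Quotient.mk_surjective u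
  ⟨v, v.2, hv⟩

end Quotient

end Colombeau

theorem mainTheorem4_general {d : ℕ} {Ω : Opens (Colombeau.Space d)} (hΩ : Colombeau.IsConic Ω)
    (α : ℝ) (u : Colombeau.GenFun Ω) :
    Colombeau.SatisfiesEuler α u ↔ Colombeau.IsHomogeneous hΩ α u := by
  obtain ⟨u, hu, rfl⟩ := Colombeau.exists_mk_eq u
  rw [Colombeau.satisfiesEuler_mk_iff, Colombeau.isHomogeneous_mk_iff]
  exact ⟨Colombeau.isNegligible_weightedDilation_sub hΩ hu, Colombeau.isNegligible_eulerOp hΩ hu⟩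

theorem mainTheorem4 (d : ℕ) (hd : 1 ≤ d) (α : ℝ) :
    (∀ u : Colombeau.GenFun (Colombeau.whole d),
      Colombeau.SatisfiesEuler α u ↔
        Colombeau.IsHomogeneous (Colombeau.isConic_whole d) α u) ∧
    (∀ u : Colombeau.GenFun (Colombeau.punctured d),
      Colombeau.SatisfiesEuler α u ↔
        Colombeau.IsHomogeneous (Colombeau.isConic_punctured d) α u) := by
  exact ⟨mainTheorem4_general _ α, mainTheorem4_general _ α⟩
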